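/- Let $\Omega=(-\infty,0)\times\mathbb{R}$ and let $m'=(m_1,m_2)\in H^1(\Omega,\mathbb{R}^2)$. Extend $m'$ by zero to $\mathbb{R}^2$, i.e. identify $m'$ with $m'\mathbf{1}_\Omega\in L^2(\mathbb{R}^2,\mathbb{R}^2)$, and let $\nabla\cdot m'$ be its divergence in the sense of tempered distributions on $\mathbb{R}^2$. Put $$\|\nabla\cdot m'\|^2_{\dot H^{-1/2}(\mathbb{R}^2)}=\int_{\mathbb{R}^2}\bigl|\,|\nabla|^{-1/2}(\nabla\cdot m')\bigr|^2\,dx:=\int_{\mathbb{R}^2}\frac{1}{|\xi|}\,|\mathcal{F}(\nabla\cdot m')(\xi)|^2\,d\xi ,$$ where $\mathcal F$ is the unitary Fourier transform, $\mathcal F f(\xi)=\frac1{2\pi}\int_{\mathbb{R}^2}e^{-i\xi\cdot x}f(x)\,dx$. If $$\int_{\mathbb{R}^2}\bigl|\,|\nabla|^{-1/2}(\nabla\cdot m')\bigr|^2\,dx<\infty ,$$ then $m_1(0,\cdot)=0$ in $H^{1/2}(\mathbb{R})$, where $m_1(0,\cdot)\in H^{1/2}(\mathbb{R})$ denotes the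 trace of $m_1\in H^1(\Omega)$ on the line $\{x_1=0\}$. -/

import Mathlib

open MeasureTheory Filter Topology
open scoped ENNReal ContDiff SchwartzMap FourierTransform LineDeriv

noncomputable section

/-- The Euclidean plane `ℝ²`; the coordinates `x₁, x₂` are written `x 0, x 1`. -/
abbrev Plane : Type := EuclideanSpace ℝ (Fin 2)

/-- The `i`-th standard basis vector of the plane. -/
def stdVec (i : Fin 2) : Plane := EuclideanSpace.single i (1 : ℝ)

/-- The open half-plane `(-∞, 0) × ℝ`. -/
def halfPlane : Set Plane := {x | x 0 < 0}

theorem measurableSet_halfPlane : MeasurableSet halfPlane :=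
  (isOpen_lt (by fun_prop) continuous_const).measurableSet

section Sobolev

variable {F : Type*} [NormedAddCommGroup F] [NormedSpace ℝ F]

/-- `w` is the weak partial derivative `∂ᵢ u` on the open set `Ω`
(used for `u` and `w` in `L²(Ω)`, so that all integrals converge). -/
def IsWeakPartial (Ω : Set Plane) (i : Fin 2) (u w : Plane → F) : Prop :=
  ∀ φ : Plane → ℝ, ContDiff ℝ ∞ φ → HasCompactSupport φ → tsupport φ ⊆ Ω →
    ∫ x in Ω, (fderiv ℝ φ x (stdVec i)) • u x = - ∫ x in Ω, φ x • w x

/-- `u ∈ H¹(Ω, F)`, and `w` is its weak gradient: `u`, `w 0` and `w 1` are in `L²(Ω, F)`. -/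
structure IsH1WithGradient (Ω : Set Plane) (u : Plane → F) (w : Fin 2 → Plane → F) : Prop where
  memLp : MemLp u 2 (volume.restrict Ω)
  memLp_grad : ∀ i, MemLp (w i) 2 (volume.restrict Ω)
  weak : ∀ i, IsWeakPartial Ω i u (w i)

/-- The Sobolev space `H¹(Ω, F)`. Only the values of `u` on `Ω` matter. -/
def MemH1 (Ω : Set Plane) (u : Plane → F) : Prop :=
  ∃ w : Fin 2 → Plane → F, IsH1WithGradient Ω u w

/-- The extension by zero of an `H¹` map is square integrable on the whole plane. -/
theorem MemH1.memLp_indicator {Ω : Set Plane} {u : Plane → F} (hu : MemH1 Ω u)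
    (hΩ : MeasurableSet Ω) : MemLp (Ω.indicator u) 2 volume :=
  (memLp_indicator_iff_restrict hΩ).2 hu.choose_spec.memLp

end Sobolev

/-- A coordinate of an `L²` vector field, as a complex valued `L²` function. -/
theorem memLp_coord {v : Plane → Plane} (hv : MemLp v 2 volume) (i : Fin 2) :
    MemLp (fun x => ((v x i : ℝ) : ℂ)) 2 volume :=
  (Complex.ofRealCLM.comp (EuclideanSpace.proj i : Plane →L[ℝ] ℝ)).comp_memLp' hv

/-- The distributional divergence `∇ · v = ∂₁ v₁ + ∂₂ v₂` on `ℝ²` of an `L²` vector field `v`,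
as a tempered distribution. -/
def distDiv (v : Plane → Plane) (hv : MemLp v 2 volume) : 𝓢'(Plane, ℂ) :=
  ∑ i : Fin 2, ∂_{stdVec i} (((memLp_coord hv i).toLp _ : Lp ℂ 2 (volume : Measure Plane)) :
    𝓢'(Plane, ℂ))

/-- The tempered distribution `T` is given by integration against the function `f`. -/
def IsRepresentedBy (T : 𝓢'(Plane, ℂ)) (f : Plane → ℂ) : Prop :=
  AEStronglyMeasurable f volume ∧
    ∀ φ : 𝓢(Plane, ℂ), Integrable (fun ξ => φ ξ * f ξ) volume ∧ T φ = ∫ ξ, φ ξ * f ξ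

/-- The squared homogeneous seminorm `‖T‖²_{Ḣ^{-1/2}(ℝ²)} = ∫ | |∇|^{-1/2} T |² dx`, computed in
Fourier space as `∫ |ξ|⁻¹ |𝓕 T|² dξ`; it is `∞` if `𝓕 T` is not a function. The function
representing `𝓕 T` is unique up to null sets, so the infimum is over a single value. In Mathlib's
normalization `𝓕 f ξ = ∫ exp (-2πi x·ξ) f x dx` the Fourier symbol of `|∇|` is `2π|ξ|`. -/
def hDotNegHalfSq (T : 𝓢'(Plane, ℂ)) : ℝ≥0∞ :=
  ⨅ (f : Plane → ℂ) (_ : IsRepresentedBy (𝓕 T) f),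
    ∫⁻ ξ, ‖f ξ‖ₑ ^ 2 / ENNReal.ofReal (2 * Real.pi * ‖ξ‖)

/-- The squared norm of `H^{1/2}(ℝ)`:
`‖g‖²_{L²} + ∬ |g(s) - g(t)|² / |s - t|² ds dt`. -/
def hHalfNormSq (g : ℝ → ℝ) : ℝ≥0∞ :=
  (∫⁻ s, ‖g s‖ₑ ^ 2) + ∫⁻ s, ∫⁻ t, ‖g s - g t‖ₑ ^ 2 / ‖s - t‖ₑ ^ 2

/-- The space `H^{1/2}(ℝ)`. -/
def MemHHalf (g : ℝ → ℝ) : Prop :=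
  AEStronglyMeasurable g volume ∧ hHalfNormSq g < ⊤

/-- `g ∈ H^{1/2}(ℝ)` is the trace `u(0, ·)` of `u ∈ H¹((-∞,0) × ℝ)` on the line `{x₁ = 0}`: there
are `v n ∈ C_c^∞(ℝ²)` whose restrictions to the half-plane converge to `u` in `H¹` and whose
restrictions `v n (0, ·)` to the line converge to `g` in `H^{1/2}(ℝ)`. -/
def IsTrace (u : Plane → ℝ) (g : ℝ → ℝ) : Prop :=
  MemHHalf g ∧
  ∃ w : Fin 2 → Plane → ℝ, IsH1WithGradient halfPlane u w ∧
  ∃ v : ℕ → Plane → ℝ,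
    (∀ n, ContDiff ℝ ∞ (v n) ∧ HasCompactSupport (v n)) ∧
    Tendsto (fun n => eLpNorm (fun x => v n x - u x) 2 (volume.restrict halfPlane))
      atTop (𝓝 0) ∧
    (∀ i, Tendsto (fun n => eLpNorm (fun x => fderiv ℝ (v n) x (stdVec i) - w i x) 2
      (volume.restrict halfPlane)) atTop (𝓝 0)) ∧
    Tendsto (fun n => hHalfNormSq (fun s => v n !₂[(0 : ℝ), s] - g s)) atTop (𝓝 0)

end

/-!
The distribution `∇ · (m 1_Ω)` is the sum of the bulk divergence `(∇ · m) 1_Ω`, which is in `L²`,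
and the layer `- m₁(0, ·) δ_{x₁ = 0}`. The Fourier transform of the layer does not depend on `ξ₁`,
so it cannot be square integrable against `1 / |ξ|` at infinity unless it is zero.

To run this without a trace theorem, the layer is encoded by the boundary term
`J φ = ∫_Ω (∂₁φ m₁ + φ ∂₁m₁)`. It is unchanged when `φ` is multiplied by `exp (2πi t x₁)`, since
integration by parts on `Ω` produces no boundary term for test functions vanishing on the line
(`IsWeakPartial.integral_of_vanish`). Hence the pairing of the divergence with
`φ exp (2πi t x₁)` is `- J φ` plus the pairing with the bulk divergence (`distDiv_modulate`), and
the latter tends to `0` as `t → ∞` by the Riemann-Lebesgue lemma. On the Fourier side the same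
pairing is `∫ f ψ(· + t e₁)` with `f` the transform of the divergence and `ψ` a Schwartz function;
if `∫ |f|² / |ξ| < ∞`, it is arbitrarily small for suitable large `t`
(`exists_lintegral_translate_lt`), because `1 / (1 + t)` is not integrable at infinity. So `J = 0`
(`boundary_term_eq_zero`).

Any trace of `m₁` is then orthogonal to all restrictions of test functions to the line
(`IsTrace.ae_eq_zero`). The existence of a trace needs no theory of `H^{1/2}`: as `J = 0`, the
extension of `m₁` by zero is in `H¹(ℝ²)`, and mollifying it with kernels supported in `{x₁ < 0}`
gives smooth approximations that vanish on the line (`isTrace_zero`).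
-/

/-! ### Integration by parts without boundary contribution -/

/-- A smooth function on the line that vanishes on `[-1, ∞)` and is `1` on `(-∞, -2]`. -/
noncomputable def leftCutoff (s : ℝ) : ℝ := Real.smoothTransition (-s - 1)

theorem leftCutoff_contDiff : ContDiff ℝ ∞ leftCutoff :=
  Real.smoothTransition.contDiff.comp (by fun_prop)

theorem leftCutoff_of_le {s : ℝ} (h : s ≤ -2) : leftCutoff s = 1 :=
  Real.smoothTransition.one_of_one_le (by linarith)

theorem leftCutoff_of_ge {s : ℝ} (h : -1 ≤ s) : leftCutoff s = 0 :=
  Real.smoothTransition.zero_of_nonpos (by linarith)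

theorem abs_leftCutoff_le (s : ℝ) : |leftCutoff s| ≤ 1 := by
  rw [leftCutoff, abs_of_nonneg (Real.smoothTransition.nonneg _)]
  exact Real.smoothTransition.le_one _

theorem deriv_leftCutoff_of_lt {s : ℝ} (h : s < -2) : deriv leftCutoff s = 0 := by
  have : leftCutoff =ᶠ[𝓝 s] fun _ => (1 : ℝ) := by
    filter_upwards [Iio_mem_nhds h] with t ht using leftCutoff_of_le (le_of_lt ht)
  rw [this.deriv_eq, deriv_const]

theorem deriv_leftCutoff_of_gt {s : ℝ} (h : -1 < s) : deriv leftCutoff s = 0 := by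
  have : leftCutoff =ᶠ[𝓝 s] fun _ => (0 : ℝ) := by
    filter_upwards [Ioi_mem_nhds h] with t ht using leftCutoff_of_ge (le_of_lt ht)
  rw [this.deriv_eq, deriv_const]

theorem exists_abs_mul_deriv_leftCutoff_le :
    ∃ M : ℝ, 0 ≤ M ∧ ∀ s, |s * deriv leftCutoff s| ≤ M := by
  have hc : Continuous fun s => s * deriv leftCutoff s :=
    continuous_id.mul (leftCutoff_contDiff.continuous_deriv (by simp))
  obtain ⟨M, hM⟩ := (isCompact_Icc (a := (-2 : ℝ)) (b := -1)).exists_bound_of_continuousOn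
    hc.continuousOn
  refine ⟨max M 0, le_max_right _ _, fun s => ?_⟩
  by_cases h : s ∈ Set.Icc (-2 : ℝ) (-1)
  · exact (hM s h).trans (le_max_left _ _)
  · have : deriv leftCutoff s = 0 := by
      rw [Set.mem_Icc, not_and_or, not_le, not_le] at h
      exact h.elim deriv_leftCutoff_of_lt deriv_leftCutoff_of_gt
    simp [this]

/-- A smooth function with compact support that vanishes on the line `{x₁ = 0}` is bounded by a
multiple of `|x₁|`. -/
theorem exists_abs_le_of_vanish {φ : Plane → ℝ} (hφ : ContDiff ℝ ∞ φ) (hc : HasCompactSupport φ)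
    (h0 : ∀ x, x 0 = 0 → φ x = 0) : ∃ C : ℝ, 0 ≤ C ∧ ∀ x, |φ x| ≤ C * |x 0| := by
  obtain ⟨C, hC⟩ := hφ.lipschitzWith_of_hasCompactSupport hc (by simp)
  refine ⟨C, C.2, fun x => ?_⟩
  have h1 := hC.dist_le_mul x (x - x 0 • stdVec 0)
  have h2 : φ (x - x 0 • stdVec 0) = 0 := h0 _ (by simp [stdVec])
  rw [h2] at h1
  simpa [dist_eq_norm, norm_smul, stdVec] using h1

theorem continuous_fderiv_stdVec {E : Type*} [NormedAddCommGroup E] [NormedSpace ℝ E]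
    {φ : Plane → E} (hφ : ContDiff ℝ ∞ φ) (i : Fin 2) :
    Continuous fun x => fderiv ℝ φ x (stdVec i) :=
  (hφ.continuous_fderiv (by simp)).clm_apply continuous_const

theorem hasCompactSupport_fderiv_stdVec {E : Type*} [NormedAddCommGroup E] [NormedSpace ℝ E]
    {φ : Plane → E} (hc : HasCompactSupport φ) (i : Fin 2) :
    HasCompactSupport fun x => fderiv ℝ φ x (stdVec i) :=
  hc.fderiv_apply (𝕜 := ℝ) (stdVec i)

theorem memLp_of_continuous_of_hasCompactSupport {E : Type*} [NormedAddCommGroup E]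
    {φ : Plane → E} (hφ : Continuous φ) (hc : HasCompactSupport φ) (μ : Measure Plane)
    [IsFiniteMeasureOnCompacts μ] (p : ℝ≥0∞) :
    MemLp φ p μ := hφ.memLp_of_hasCompactSupport hc

/-- The weak formulation of `∂ᵢ u = w` on the half-plane extends to test functions whose support
reaches the boundary line, if they vanish on that line, or if the direction `i` is tangential. -/
theorem IsWeakPartial.integral_of_vanish {i : Fin 2} {u w : Plane → ℝ}
    (h : IsWeakPartial halfPlane i u w) (hu : MemLp u 2 (volume.restrict halfPlane))
    (hw : MemLp w 2 (volume.restrict halfPlane)) {φ : Plane → ℝ} (hφ : ContDiff ℝ ∞ φ)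
    (hc : HasCompactSupport φ) (h0 : i = 1 ∨ ∀ x, x 0 = 0 → φ x = 0) :
    ∫ x in halfPlane, fderiv ℝ φ x (stdVec i) * u x = - ∫ x in halfPlane, φ x * w x := by
  have hproj : ∀ x : Plane, HasFDerivAt (fun y : Plane => y 0)
      (EuclideanSpace.proj 0 : Plane →L[ℝ] ℝ) x := fun x =>
    (EuclideanSpace.proj (0 : Fin 2) : Plane →L[ℝ] ℝ).hasFDerivAt
  have hprojc : ContDiff ℝ ∞ (fun y : Plane => y 0) :=
    (EuclideanSpace.proj (0 : Fin 2) : Plane →L[ℝ] ℝ).contDiff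
  set η : ℕ → Plane → ℝ := fun n x => leftCutoff (n * x 0) with hη
  have hηc : ∀ n, ContDiff ℝ ∞ (η n) := fun n =>
    leftCutoff_contDiff.comp (contDiff_const.mul hprojc)
  have hder : ∀ n x, fderiv ℝ (fun y => φ y * η n y) x (stdVec i)
      = fderiv ℝ φ x (stdVec i) * η n x
        + φ x * (deriv leftCutoff (n * x 0) * (n * stdVec i 0)) := by
    intro n x
    have h0 : HasDerivAt leftCutoff (deriv leftCutoff (n * x 0)) (n * x 0) :=
      (leftCutoff_contDiff.differentiable (by simp) _).hasDerivAt
    have h1 : HasFDerivAt (η n) (deriv leftCutoff (n * x 0) •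
        ((n : ℝ) • (EuclideanSpace.proj 0 : Plane →L[ℝ] ℝ))) x :=
      HasDerivAt.comp_hasFDerivAt (h₂ := leftCutoff) x h0 ((hproj x).const_mul (n : ℝ))
    have h2 := ((hφ.differentiable (by simp) x).hasFDerivAt.mul h1).fderiv
    rw [show (fun y => φ y * η n y) = φ * η n from rfl, h2]
    simp
    ring
  obtain ⟨M, hM0, hM⟩ := exists_abs_mul_deriv_leftCutoff_le
  -- the derivative of the cutoff is of order `n`, but only where `|φ|` is of order `1 / n`
  obtain ⟨C, hC0, hC⟩ : ∃ C : ℝ, 0 ≤ C ∧ ∀ (n : ℕ) x,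
      |φ x * (deriv leftCutoff (n * x 0) * (n * stdVec i 0))| ≤ C := by
    rcases h0 with rfl | h0
    · exact ⟨0, le_rfl, fun n x => by simp [stdVec]⟩
    · obtain ⟨C, hC0, hC⟩ := exists_abs_le_of_vanish hφ hc h0
      refine ⟨C * M, by positivity, fun n x => ?_⟩
      have hs : |stdVec i 0| ≤ 1 := by
        fin_cases i <;> simp [stdVec]
      calc |φ x * (deriv leftCutoff (n * x 0) * (n * stdVec i 0))|
          = |φ x| * (|deriv leftCutoff (n * x 0)| * (n * |stdVec i 0|)) := by
            simp [abs_mul]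
        _ ≤ (C * |x 0|) * (|deriv leftCutoff (n * x 0)| * (n * 1)) := by
            gcongr
            exact hC x
        _ = C * |(n * x 0) * deriv leftCutoff (n * x 0)| := by
            simp [abs_mul]
            ring
        _ ≤ C * M := by
            gcongr
            exact hM _
  have hD := continuous_fderiv_stdVec hφ i
  obtain ⟨K, hK⟩ := (hasCompactSupport_fderiv_stdVec hc i).exists_bound_of_continuous hD
  -- the common integrable bound
  have hind : MemLp ((tsupport φ).indicator fun _ => K + C) 2 (volume.restrict halfPlane) :=
    memLp_indicator_const 2 (isClosed_tsupport φ).measurableSet _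
      (Or.inr ((Measure.restrict_apply_le _ _).trans_lt hc.isCompact.measure_lt_top).ne)
  have hlim : ∀ x ∈ halfPlane, ∀ᶠ n : ℕ in atTop, (n : ℝ) * x 0 < -2 := by
    intro x hx
    have hx' : x 0 < 0 := hx
    exact (tendsto_natCast_atTop_atTop.atTop_mul_const_of_neg hx').eventually_lt_atBot _
  have hL : Tendsto (fun n : ℕ => ∫ x in halfPlane,
      fderiv ℝ (fun y => φ y * η n y) x (stdVec i) * u x) atTop
      (𝓝 (∫ x in halfPlane, fderiv ℝ φ x (stdVec i) * u x)) := by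
    refine tendsto_integral_of_dominated_convergence
      (fun x => (tsupport φ).indicator (fun _ => K + C) x * ‖u x‖) ?_ ?_ ?_ ?_
    · exact fun n => (continuous_fderiv_stdVec (hφ.mul (hηc n)) i).aestronglyMeasurable.mul
        hu.aestronglyMeasurable
    · exact hind.integrable_mul hu.norm
    · refine fun n => Eventually.of_forall fun x => ?_
      rw [norm_mul]
      gcongr
      rw [hder]
      by_cases hx : x ∈ tsupport φ
      · rw [Set.indicator_of_mem hx]
        refine (norm_add_le _ _).trans (add_le_add ?_ (hC n x))
        rw [norm_mul]
        calc _ ≤ K * 1 := by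
              gcongr
              · exact (norm_nonneg _).trans (hK x)
              · exact hK x
              · exact abs_leftCutoff_le _
          _ = K := mul_one K
      · have h1 : φ x = 0 := image_eq_zero_of_notMem_tsupport hx
        have h2 : fderiv ℝ φ x = 0 := by
          by_contra hne
          exact hx (support_fderiv_subset ℝ hne)
        simp [h1, h2, hx]
    · refine (ae_restrict_iff' measurableSet_halfPlane).2 (Eventually.of_forall fun x hx => ?_)
      refine tendsto_const_nhds.congr' ?_
      filter_upwards [hlim x hx] with n hn
      rw [hder, deriv_leftCutoff_of_lt hn]
      simp [hη, leftCutoff_of_le hn.le]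
  have hR : Tendsto (fun n : ℕ => ∫ x in halfPlane, (φ x * η n x) * w x) atTop
      (𝓝 (∫ x in halfPlane, φ x * w x)) := by
    refine tendsto_integral_of_dominated_convergence (fun x => ‖φ x‖ * ‖w x‖) ?_ ?_ ?_ ?_
    · exact fun n => (hφ.continuous.mul (hηc n).continuous).aestronglyMeasurable.mul
        hw.aestronglyMeasurable
    · exact (memLp_of_continuous_of_hasCompactSupport hφ.continuous hc _ 2).norm.integrable_mul
        hw.norm
    · refine fun n => Eventually.of_forall fun x => ?_
      rw [norm_mul, norm_mul]
      gcongr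
      exact mul_le_of_le_one_right (norm_nonneg _) (abs_leftCutoff_le _)
    · refine (ae_restrict_iff' measurableSet_halfPlane).2 (Eventually.of_forall fun x hx => ?_)
      refine tendsto_const_nhds.congr' ?_
      filter_upwards [hlim x hx] with n hn
      simp [hη, leftCutoff_of_le hn.le]
  refine tendsto_nhds_unique hL (hR.neg.congr' ?_)
  filter_upwards [eventually_gt_atTop 0] with n hn
  have hn' : (0 : ℝ) < n := by exact_mod_cast hn
  refine (h (fun y => φ y * η n y) (hφ.mul (hηc n)) hc.mul_right ?_).symm
  have hcl : IsClosed {x : Plane | (n : ℝ) * x 0 ≤ -1} :=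
    isClosed_le (by fun_prop) continuous_const
  refine (closure_minimal (fun x hx => ?_) hcl).trans fun x (hx : (n : ℝ) * x 0 ≤ -1) => ?_
  · by_contra hlt
    rw [Set.mem_ofPred_eq, not_le] at hlt
    exact hx (by simp [hη, leftCutoff_of_ge hlt.le])
  · change x 0 < 0
    by_contra hge
    rw [not_lt] at hge
    nlinarith [mul_nonneg hn'.le hge]

theorem IsWeakPartial.integral_complex_of_vanish {i : Fin 2} {u w : Plane → ℝ}
    (h : IsWeakPartial halfPlane i u w) (hu : MemLp u 2 (volume.restrict halfPlane))
    (hw : MemLp w 2 (volume.restrict halfPlane)) {φ : Plane → ℂ} (hφ : ContDiff ℝ ∞ φ)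
    (hc : HasCompactSupport φ) (h0 : i = 1 ∨ ∀ x, x 0 = 0 → φ x = 0) :
    ∫ x in halfPlane, fderiv ℝ φ x (stdVec i) * u x = - ∫ x in halfPlane, φ x * w x := by
  have hI1 : Integrable (fun x => fderiv ℝ φ x (stdVec i) * (u x : ℂ))
      (volume.restrict halfPlane) :=
    (memLp_of_continuous_of_hasCompactSupport (continuous_fderiv_stdVec hφ i)
      (hasCompactSupport_fderiv_stdVec hc i) _ 2).integrable_mul hu.ofReal
  have hI2 : Integrable (fun x => φ x * (w x : ℂ)) (volume.restrict halfPlane) :=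
    (memLp_of_continuous_of_hasCompactSupport hφ.continuous hc _ 2).integrable_mul hw.ofReal
  have key : ∀ L : ℂ →L[ℝ] ℝ, (∀ (z : ℂ) (r : ℝ), L (z * r) = L z * r) →
      L (∫ x in halfPlane, fderiv ℝ φ x (stdVec i) * u x)
        = L (- ∫ x in halfPlane, φ x * w x) := by
    intro L hL
    rw [map_neg, ← L.integral_comp_comm hI1, ← L.integral_comp_comm hI2]
    simp only [hL]
    have hd : ∀ x, L (fderiv ℝ φ x (stdVec i)) = fderiv ℝ (fun y => L (φ y)) x (stdVec i) := by
      intro x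
      have := (L.hasFDerivAt.comp x (hφ.differentiable (by simp) x).hasFDerivAt).fderiv
      change fderiv ℝ (fun y => L (φ y)) x = _ at this
      rw [this]
      rfl
    simp only [hd]
    refine h.integral_of_vanish hu hw (L.contDiff.comp hφ) (hc.comp_left (map_zero L)) ?_
    exact h0.imp_right fun h0 x hx => by simp [h0 x hx]
  exact Complex.ext (key Complex.reCLM (by simp)) (key Complex.imCLM (by simp))

/-! ### The boundary term and the Fourier transform of the divergence -/

theorem distDiv_indicator_apply {m : Plane → Plane}
    (hv : MemLp (halfPlane.indicator m) 2 volume) (φ : 𝓢(Plane, ℂ)) :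
    distDiv (halfPlane.indicator m) hv φ
      = -∑ i : Fin 2, ∫ x in halfPlane, fderiv ℝ φ x (stdVec i) * (m x i : ℂ) := by
  have hi : ∀ i : Fin 2, (∂_{stdVec i} (((memLp_coord hv i).toLp _ :
      Lp ℂ 2 (volume : Measure Plane)) : 𝓢'(Plane, ℂ))) φ
      = -∫ x in halfPlane, fderiv ℝ φ x (stdVec i) * (m x i : ℂ) := by
    intro i
    rw [TemperedDistribution.lineDerivOp_apply_apply, Lp.toTemperedDistribution_apply,
      ← integral_neg, ← integral_indicator measurableSet_halfPlane]
    refine integral_congr_ae ?_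
    filter_upwards [(memLp_coord hv i).coeFn_toLp] with x hx
    rw [hx, neg_apply, SchwartzMap.lineDerivOp_apply_eq_fderiv]
    by_cases hm : x ∈ halfPlane <;> simp [hm]
  rw [distDiv, Fin.sum_univ_two, Fin.sum_univ_two, neg_add, ← hi 0, ← hi 1]
  rfl

/-- A weighted arithmetic-geometric mean inequality that holds for all weights `s`, including `0`
and `∞`. -/
theorem le_sq_div_add (x s : ℝ≥0∞) (hx : x ≠ ⊤) : x ≤ x ^ 2 / s + s := by
  rcases le_or_gt x s with h | h
  · exact h.trans le_add_self
  · refine le_add_right ?_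
    have h0 : x ≠ 0 := (bot_le.trans_lt h).ne'
    calc x = x ^ 2 / x := by
          rw [sq, ENNReal.mul_div_cancel_right h0 hx]
      _ ≤ x ^ 2 / s := by gcongr

/-- The first moment of a Schwartz function translated by `t` along the `ξ₁`-axis grows at most
linearly in `t`. -/
theorem exists_lintegral_norm_mul_translate_le (ψ : 𝓢(Plane, ℂ)) :
    ∃ C : ℝ≥0∞, C ≠ ⊤ ∧ ∀ t : ℝ, 0 ≤ t →
      ∫⁻ ξ, ENNReal.ofReal (2 * Real.pi * ‖ξ‖) * ‖ψ (ξ + t • stdVec 0)‖ₑ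
        ≤ ENNReal.ofReal (1 + t) * C := by
  refine ⟨∫⁻ ξ, ENNReal.ofReal (2 * Real.pi * (1 + ‖ξ‖)) * ‖ψ ξ‖ₑ, ?_, fun t ht => ?_⟩
  · have h1 : Integrable (fun ξ => (2 * Real.pi) * (‖ξ‖ ^ 0 * ‖ψ ξ‖ + ‖ξ‖ ^ 1 * ‖ψ ξ‖)) :=
      ((ψ.integrable_pow_mul volume 0).add (ψ.integrable_pow_mul volume 1)).const_mul _
    refine (lt_of_le_of_lt (lintegral_mono fun ξ => ?_) h1.lintegral_lt_top).ne
    rw [← ofReal_norm, ← ENNReal.ofReal_mul (by positivity)]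
    refine ENNReal.ofReal_le_ofReal (le_of_eq ?_)
    ring
  · have hs : ∫⁻ ξ, ENNReal.ofReal (2 * Real.pi * ‖ξ‖) * ‖ψ (ξ + t • stdVec 0)‖ₑ
        = ∫⁻ ξ, ENNReal.ofReal (2 * Real.pi * ‖ξ - t • stdVec 0‖) * ‖ψ ξ‖ₑ := by
      rw [← lintegral_add_right_eq_self (μ := volume) (fun ξ : Plane =>
        ENNReal.ofReal (2 * Real.pi * ‖ξ - t • stdVec 0‖) * ‖ψ ξ‖ₑ) (t • stdVec 0)]
      simp
    rw [hs, ← lintegral_const_mul' _ _ ENNReal.ofReal_ne_top]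
    refine lintegral_mono fun ξ => ?_
    rw [← mul_assoc, ← ENNReal.ofReal_mul (by positivity)]
    refine mul_le_mul_left (ENNReal.ofReal_le_ofReal ?_) _
    have h2 : ‖ξ - t • stdVec 0‖ ≤ ‖ξ‖ + t := by
      refine (norm_sub_le _ _).trans ?_
      simp [stdVec, norm_smul, abs_of_nonneg ht]
    have h3 : ‖ξ‖ + t ≤ (1 + t) * (1 + ‖ξ‖) := by nlinarith [norm_nonneg ξ]
    calc 2 * Real.pi * ‖ξ - t • stdVec 0‖ ≤ 2 * Real.pi * ((1 + t) * (1 + ‖ξ‖)) := by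
          gcongr
          exact h2.trans h3
      _ = _ := by ring

/-- The integrals of a Schwartz function over the lines parallel to the `ξ₁`-axis are uniformly
bounded. -/
theorem exists_lintegral_line_le (ψ : 𝓢(Plane, ℂ)) :
    ∃ C : ℝ≥0∞, C ≠ ⊤ ∧ ∀ ξ, ∫⁻ t : ℝ, ‖ψ (ξ + t • stdVec 0)‖ₑ ≤ C := by
  obtain ⟨A, hA⟩ := ψ.decay 0 0
  obtain ⟨B, hB⟩ := ψ.decay 2 0
  have hI : Integrable fun t : ℝ => (A + B) * (1 + t ^ 2)⁻¹ :=
    integrable_inv_one_add_sq.const_mul _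
  refine ⟨∫⁻ t : ℝ, ENNReal.ofReal ((A + B) * (1 + t ^ 2)⁻¹), hI.lintegral_lt_top.ne, fun ξ => ?_⟩
  rw [← lintegral_add_left_eq_self
    (fun t : ℝ => ENNReal.ofReal ((A + B) * (1 + t ^ 2)⁻¹)) (ξ 0)]
  refine lintegral_mono fun t => ?_
  rw [← ofReal_norm]
  refine ENNReal.ofReal_le_ofReal ?_
  set y := ξ + t • stdVec 0 with hy
  have h1 := hA.2 y
  have h2 := hB.2 y
  simp only [pow_zero, one_mul, norm_iteratedFDeriv_zero] at h1 h2
  have h3 : (ξ 0 + t) ^ 2 ≤ ‖y‖ ^ 2 := by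
    have h4 : |y 0| ≤ ‖y‖ := PiLp.norm_apply_le y 0
    have h5 : y 0 = ξ 0 + t := by simp [hy, stdVec]
    rw [← h5, ← sq_abs]
    gcongr
  rw [← div_eq_mul_inv, le_div_iff₀ (by positivity)]
  nlinarith [norm_nonneg (ψ y), mul_le_mul_of_nonneg_right h3 (norm_nonneg (ψ y))]

/-- If `∫ |f|² / |ξ| < ∞`, the pairings of `|f|` with the translates of `|ψ|` by `t` along the
`ξ₁`-axis are not bounded below for large `t`. Otherwise the pairing `a t` of `|f|² / |ξ|` with the
translate would be at least a multiple of `1 / (1 + t)`, because the first moment of the translate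
grows linearly; but `a` is integrable, and `1 / (1 + t)` is not. -/
theorem exists_lintegral_translate_lt {f : Plane → ℂ} (hf : AEStronglyMeasurable f volume)
    (hfin : ∫⁻ ξ, ‖f ξ‖ₑ ^ 2 / ENNReal.ofReal (2 * Real.pi * ‖ξ‖) < ⊤) (ψ : 𝓢(Plane, ℂ))
    {δ : ℝ} (hδ : 0 < δ) {t₀ : ℝ} (ht₀ : 0 ≤ t₀) :
    ∃ t, t₀ < t ∧ ∫⁻ ξ, ‖f ξ‖ₑ * ‖ψ (ξ + t • stdVec 0)‖ₑ < ENNReal.ofReal δ := by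
  by_contra! hcon
  obtain ⟨C, hCt, hC⟩ := exists_lintegral_norm_mul_translate_le ψ
  obtain ⟨D, hDt, hD⟩ := exists_lintegral_line_le ψ
  set q : Plane → ℝ≥0∞ := fun ξ => ‖f ξ‖ₑ ^ 2 / ENNReal.ofReal (2 * Real.pi * ‖ξ‖) with hq
  have hqm : AEMeasurable q := by
    refine (hf.enorm.pow_const 2).div ?_
    exact (by fun_prop : Measurable fun ξ : Plane => ENNReal.ofReal (2 * Real.pi * ‖ξ‖)).aemeasurable
  set a : ℝ → ℝ≥0∞ := fun t => ∫⁻ ξ, q ξ * ‖ψ (ξ + t • stdVec 0)‖ₑ with ha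
  -- `a` is integrable
  have h1 : ∫⁻ t in Set.Ioi t₀, a t < ⊤ := by
    refine (setLIntegral_le_lintegral _ _).trans_lt ?_
    rw [ha, lintegral_lintegral_swap]
    · calc ∫⁻ ξ, ∫⁻ t : ℝ, q ξ * ‖ψ (ξ + t • stdVec 0)‖ₑ
          = ∫⁻ ξ, q ξ * ∫⁻ t : ℝ, ‖ψ (ξ + t • stdVec 0)‖ₑ := by
            refine lintegral_congr fun ξ => lintegral_const_mul _ ?_
            exact (by fun_prop : Continuous fun t : ℝ => ‖ψ (ξ + t • stdVec 0)‖ₑ).measurable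
        _ ≤ ∫⁻ ξ, q ξ * D := lintegral_mono fun ξ => by gcongr; exact hD ξ
        _ = (∫⁻ ξ, q ξ) * D := lintegral_mul_const'' _ hqm
        _ < ⊤ := ENNReal.mul_lt_top hfin hDt.lt_top
    · refine AEMeasurable.mul (hqm.comp_quasiMeasurePreserving Measure.quasiMeasurePreserving_snd) ?_
      exact (by fun_prop : Continuous fun p : ℝ × Plane =>
        ‖ψ (p.2 + p.1 • stdVec 0)‖ₑ).measurable.aemeasurable
  -- `a` is bounded below by a multiple of `1 / (1 + t)`
  obtain ⟨c, hc0, hc⟩ : ∃ c : ℝ, 0 < c ∧ ENNReal.ofReal c * C ≤ ENNReal.ofReal (δ / 2) := by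
    refine ⟨δ / 2 / (C.toReal + 1), by positivity, ?_⟩
    rw [← ENNReal.ofReal_toReal hCt, ← ENNReal.ofReal_mul (by positivity),
      ENNReal.toReal_ofReal ENNReal.toReal_nonneg]
    refine ENNReal.ofReal_le_ofReal ?_
    rw [div_mul_eq_mul_div, div_le_iff₀ (by positivity)]
    nlinarith [ENNReal.toReal_nonneg (a := C)]
  have h2 : ∀ t ∈ Set.Ioi t₀, ENNReal.ofReal (c * (δ / 2) / (1 + t)) ≤ a t := by
    intro t ht
    have ht0 : 0 < t := ht₀.trans_lt ht
    set r : ℝ≥0∞ := ENNReal.ofReal (c / (1 + t)) with hr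
    have hr0 : r ≠ 0 := (ENNReal.ofReal_pos.2 (by positivity)).ne'
    have hrt : r ≠ ⊤ := ENNReal.ofReal_ne_top
    -- the weight `c / (1 + t)` lets the first moment absorb only half of `δ`
    have h3 : ENNReal.ofReal δ ≤ a t / r + ENNReal.ofReal (δ / 2) := by
      calc ENNReal.ofReal δ ≤ ∫⁻ ξ, ‖f ξ‖ₑ * ‖ψ (ξ + t • stdVec 0)‖ₑ := hcon t ht
        _ ≤ ∫⁻ ξ, (r⁻¹ * (q ξ * ‖ψ (ξ + t • stdVec 0)‖ₑ)
              + r * (ENNReal.ofReal (2 * Real.pi * ‖ξ‖) * ‖ψ (ξ + t • stdVec 0)‖ₑ)) := by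
            refine lintegral_mono fun ξ => ?_
            rw [← mul_assoc, ← mul_assoc, ← add_mul]
            gcongr
            refine (le_sq_div_add _ (r * ENNReal.ofReal (2 * Real.pi * ‖ξ‖))
              enorm_ne_top).trans (le_of_eq ?_)
            simp only [hq, div_eq_mul_inv]
            rw [ENNReal.mul_inv (Or.inl hr0) (Or.inl hrt)]
            ring
        _ = r⁻¹ * a t + r * ∫⁻ ξ, ENNReal.ofReal (2 * Real.pi * ‖ξ‖)
              * ‖ψ (ξ + t • stdVec 0)‖ₑ := by
            have hψm : Measurable ψ := ψ.continuous.measurable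
            rw [lintegral_add_right _ (by fun_prop),
              lintegral_const_mul' _ _ (ENNReal.inv_ne_top.2 hr0), lintegral_const_mul' _ _ hrt]
        _ ≤ r⁻¹ * a t + r * (ENNReal.ofReal (1 + t) * C) := by
            gcongr
            exact hC t ht0.le
        _ = a t / r + ENNReal.ofReal c * C := by
            rw [← mul_assoc, hr, ← ENNReal.ofReal_mul (by positivity),
              div_mul_cancel₀ _ (by positivity), ← hr, mul_comm, div_eq_mul_inv]
        _ ≤ _ := by gcongr
    have h4 : ENNReal.ofReal (δ / 2) ≤ a t / r := by
      have h5 : ENNReal.ofReal δ = ENNReal.ofReal (δ / 2) + ENNReal.ofReal (δ / 2) := by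
        rw [← ENNReal.ofReal_add (by positivity) (by positivity), add_halves]
      rw [h5] at h3
      exact (ENNReal.add_le_add_iff_right ENNReal.ofReal_ne_top).1 h3
    rw [ENNReal.le_div_iff_mul_le (Or.inl hr0) (Or.inl hrt), hr,
      ← ENNReal.ofReal_mul (by positivity)] at h4
    convert h4 using 2
    ring
  have h3 : IntegrableOn (fun t : ℝ => c * (δ / 2) / (1 + t)) (Set.Ioi t₀) := by
    refine ⟨(by fun_prop : Measurable fun t : ℝ => c * (δ / 2) / (1 + t)).aestronglyMeasurable, ?_⟩
    rw [hasFiniteIntegral_iff_ofReal]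
    · exact (setLIntegral_mono' measurableSet_Ioi h2).trans_lt h1
    · refine (ae_restrict_iff' measurableSet_Ioi).2 (Eventually.of_forall fun t ht => ?_)
      have ht0 : 0 < t := ht₀.trans_lt ht
      change 0 ≤ c * (δ / 2) / (1 + t)
      positivity
  have h4 : IntegrableOn (fun t : ℝ => (1 + t)⁻¹) (Set.Ioi t₀) := by
    refine (h3.const_mul (c * (δ / 2))⁻¹).congr (Eventually.of_forall fun t => ?_)
    change (c * (δ / 2))⁻¹ * (c * (δ / 2) / (1 + t)) = (1 + t)⁻¹
    rw [div_eq_mul_inv (c * (δ / 2)), inv_mul_cancel_left₀ (by positivity)]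
  have h5 := (measurePreserving_add_left volume (1 : ℝ)).integrableOn_comp_preimage
    (measurableEmbedding_addLeft 1) (f := fun t : ℝ => t⁻¹) (s := Set.Ioi (1 + t₀))
  rw [Set.preimage_const_add_Ioi, add_sub_cancel_left] at h5
  exact not_integrableOn_Ioi_inv (h5.1 h4)

/-- The oscillating test functions `x ↦ φ x * exp (2πi t x₁)`. -/
noncomputable def modulate (φ : Plane → ℝ) (t : ℝ) (x : Plane) : ℂ :=
  (φ x : ℂ) * Real.fourierChar (inner ℝ x (t • stdVec 0))

theorem modulate_contDiff {φ : Plane → ℝ} (hφ : ContDiff ℝ ∞ φ) (t : ℝ) :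
    ContDiff ℝ ∞ (modulate φ t) := by
  refine (Complex.ofRealCLM.contDiff.comp hφ).mul ?_
  simp only [Real.fourierChar_apply]
  have h : ContDiff ℝ ∞ fun x : Plane => 2 * Real.pi * inner ℝ x (t • stdVec 0) :=
    contDiff_const.mul (contDiff_id.inner ℝ contDiff_const)
  exact (((Complex.ofRealCLM.contDiff.comp h).mul contDiff_const).cexp)

theorem modulate_hasCompactSupport {φ : Plane → ℝ} (hc : HasCompactSupport φ) (t : ℝ) :
    HasCompactSupport (modulate φ t) :=
  (hc.comp_left Complex.ofReal_zero).mul_right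

theorem modulate_zero (φ : Plane → ℝ) : modulate φ 0 = fun x => (φ x : ℂ) := by
  ext x
  simp [modulate]

theorem modulate_of_line (φ : Plane → ℝ) (t : ℝ) {x : Plane} (hx : x 0 = 0) :
    modulate φ t x = φ x := by
  simp [modulate, stdVec, inner_smul_right, EuclideanSpace.inner_single_right, hx]

/-- Modulation is translation on the Fourier side. -/
theorem fourierInv_modulate (φ : Plane → ℝ) (t : ℝ) (ξ : Plane) :
    𝓕⁻ (modulate φ t) ξ = 𝓕⁻ (modulate φ 0) (ξ + t • stdVec 0) := by
  rw [Real.fourierInv_eq, Real.fourierInv_eq, modulate_zero]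
  refine integral_congr_ae (Eventually.of_forall fun x => ?_)
  simp only [modulate, inner_add_right, AddChar.map_add_eq_mul, Circle.smul_def, Circle.coe_mul,
    smul_eq_mul]
  ring

section

variable {m : Plane → Plane} {a b : Plane → ℝ}

/-- The pairing of `T = ∇ · (m 1_Ω)` with `φ exp (2πi t x₁)` is the pairing with the bulk
divergence `a + b`, minus a boundary term that does not depend on `t`. -/
theorem distDiv_modulate (hm : MemLp m 2 (volume.restrict halfPlane))
    (hv : MemLp (halfPlane.indicator m) 2 volume)
    (ha : MemLp a 2 (volume.restrict halfPlane)) (hb : MemLp b 2 (volume.restrict halfPlane))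
    (hma : IsWeakPartial halfPlane 0 (fun x => m x 0) a)
    (hmb : IsWeakPartial halfPlane 1 (fun x => m x 1) b) {φ : Plane → ℝ} (hφ : ContDiff ℝ ∞ φ)
    (hc : HasCompactSupport φ) (t : ℝ) :
    distDiv (halfPlane.indicator m) hv
        ((modulate_hasCompactSupport hc t).toSchwartzMap (modulate_contDiff hφ t))
      = (∫ x in halfPlane, modulate φ t x * ((a x + b x : ℝ) : ℂ))
        - ((∫ x in halfPlane, (fderiv ℝ φ x (stdVec 0) * m x 0 + φ x * a x) : ℝ) : ℂ) := by
  have hm0 : ∀ i, MemLp (fun x => m x i) 2 (volume.restrict halfPlane) := fun i =>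
    (EuclideanSpace.proj i : Plane →L[ℝ] ℝ).comp_memLp' hm
  have hφt := modulate_contDiff hφ t
  have hct := modulate_hasCompactSupport hc t
  have hd0 : ∀ x, fderiv ℝ (fun y => (φ y : ℂ)) x (stdVec 0) = fderiv ℝ φ x (stdVec 0) := by
    intro x
    have := (Complex.ofRealCLM.hasFDerivAt.comp x
      (hφ.differentiable (by simp) x).hasFDerivAt).fderiv
    change fderiv ℝ (fun y => (φ y : ℂ)) x = _ at this
    rw [this]
    rfl
  have hφC : ContDiff ℝ ∞ fun y => (φ y : ℂ) := Complex.ofRealCLM.contDiff.comp hφ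
  have hcC : HasCompactSupport fun y => (φ y : ℂ) := hc.comp_left Complex.ofReal_zero
  have I1 : ∀ {χ : Plane → ℂ} {u : Plane → ℝ}, ContDiff ℝ ∞ χ → HasCompactSupport χ →
      MemLp u 2 (volume.restrict halfPlane) →
      Integrable (fun x => χ x * (u x : ℂ)) (volume.restrict halfPlane) := fun hχ hχc hu =>
    (memLp_of_continuous_of_hasCompactSupport hχ.continuous hχc _ 2).integrable_mul hu.ofReal
  have I2 : ∀ {χ : Plane → ℂ} {u : Plane → ℝ}, ContDiff ℝ ∞ χ → HasCompactSupport χ →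
      MemLp u 2 (volume.restrict halfPlane) →
      Integrable (fun x => fderiv ℝ χ x (stdVec 0) * (u x : ℂ)) (volume.restrict halfPlane) :=
    fun hχ hχc hu => (memLp_of_continuous_of_hasCompactSupport (continuous_fderiv_stdVec hχ 0)
      (hasCompactSupport_fderiv_stdVec hχc 0) _ 2).integrable_mul hu.ofReal
  have h1 := hmb.integral_complex_of_vanish (hm0 1) hb hφt hct (Or.inl rfl)
  -- `modulate φ t - φ` vanishes on the line, so all boundary contributions come from `φ`
  have h0 := hma.integral_complex_of_vanish (hm0 0) ha (hφt.sub hφC) (hct.sub hcC)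
    (Or.inr fun x hx => by simp [modulate_of_line φ t hx])
  have hsub : ∀ x, fderiv ℝ (fun y => modulate φ t y - (φ y : ℂ)) x (stdVec 0)
      = fderiv ℝ (modulate φ t) x (stdVec 0) - fderiv ℝ (fun y => (φ y : ℂ)) x (stdVec 0) := by
    intro x
    rw [fderiv_fun_sub (hφt.differentiable (by simp) x) (hφC.differentiable (by simp) x)]
    rfl
  simp only [hsub, sub_mul] at h0
  rw [integral_sub (I2 hφt hct (hm0 0)) (I2 hφC hcC (hm0 0)),
    integral_sub (I1 hφt hct ha) (I1 hφC hcC ha)] at h0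
  have hbd : ((∫ x in halfPlane, (fderiv ℝ φ x (stdVec 0) * m x 0 + φ x * a x) : ℝ) : ℂ)
      = (∫ x in halfPlane, fderiv ℝ (fun y => (φ y : ℂ)) x (stdVec 0) * (m x 0 : ℂ))
        + ∫ x in halfPlane, (φ x : ℂ) * (a x : ℂ) := by
    rw [← integral_add (I2 hφC hcC (hm0 0)) (I1 hφC hcC ha), ← integral_complex_ofReal]
    simp [hd0]
  have hab : ∫ x in halfPlane, modulate φ t x * ((a x + b x : ℝ) : ℂ)
      = (∫ x in halfPlane, modulate φ t x * (a x : ℂ))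
        + ∫ x in halfPlane, modulate φ t x * (b x : ℂ) := by
    rw [← integral_add (I1 hφt hct ha) (I1 hφt hct hb)]
    simp [mul_add]
  rw [distDiv_indicator_apply, Fin.sum_univ_two]
  change -((∫ x in halfPlane, fderiv ℝ (modulate φ t) x (stdVec 0) * (m x 0 : ℂ))
    + ∫ x in halfPlane, fderiv ℝ (modulate φ t) x (stdVec 1) * (m x 1 : ℂ)) = _
  rw [hbd, hab, h1]
  linear_combination -h0

/-- The Riemann-Lebesgue lemma: the bulk part of the pairing vanishes at high frequency. -/
theorem tendsto_integral_modulate (φ d : Plane → ℝ) :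
    Tendsto (fun t => ∫ x in halfPlane, modulate φ t x * (d x : ℂ)) atTop (𝓝 0) := by
  have h := tendsto_integral_exp_inner_smul_cocompact
    (halfPlane.indicator fun x : Plane => (φ x : ℂ) * (d x : ℂ))
  have ht : Tendsto (fun t : ℝ => -(t • stdVec 0)) atTop (cocompact Plane) := by
    refine tendsto_cocompact_of_tendsto_dist_comp_atTop 0 ?_
    simp only [dist_zero_right, norm_neg, norm_smul, stdVec, PiLp.norm_single, norm_one, mul_one]
    exact tendsto_norm_atTop_atTop
  refine (h.comp ht).congr fun t => ?_
  rw [← integral_indicator measurableSet_halfPlane]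
  refine integral_congr_ae (Eventually.of_forall fun x => ?_)
  by_cases hx : x ∈ halfPlane
  · simp only [Set.indicator_of_mem hx, modulate, inner_neg_right, neg_neg, Circle.smul_def,
      smul_eq_mul]
    ring
  · simp [hx]

/-- If the divergence of the extension by zero is in `Ḣ^{-1/2}`, then integration by parts of the
normal component produces no boundary term: `m₁` has vanishing trace in the weak sense. -/
theorem boundary_term_eq_zero (hm : MemLp m 2 (volume.restrict halfPlane))
    (hv : MemLp (halfPlane.indicator m) 2 volume)
    (ha : MemLp a 2 (volume.restrict halfPlane)) (hb : MemLp b 2 (volume.restrict halfPlane))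
    (hma : IsWeakPartial halfPlane 0 (fun x => m x 0) a)
    (hmb : IsWeakPartial halfPlane 1 (fun x => m x 1) b)
    (hfin : hDotNegHalfSq (distDiv (halfPlane.indicator m) hv) < ⊤)
    {φ : Plane → ℝ} (hφ : ContDiff ℝ ∞ φ) (hc : HasCompactSupport φ) :
    ∫ x in halfPlane, (fderiv ℝ φ x (stdVec 0) * m x 0 + φ x * a x) = 0 := by
  simp only [hDotNegHalfSq, iInf_lt_iff] at hfin
  obtain ⟨f, ⟨hf, hrep⟩, hfin⟩ := hfin
  -- `J` is the limit of the pairings of the divergence with `modulate φ t`, up to sign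
  set J := ∫ x in halfPlane, (fderiv ℝ φ x (stdVec 0) * m x 0 + φ x * a x) with hJ
  set Φ : ℝ → 𝓢(Plane, ℂ) := fun t =>
    (modulate_hasCompactSupport hc t).toSchwartzMap (modulate_contDiff hφ t) with hΦ
  set T := distDiv (halfPlane.indicator m) hv with hT
  by_contra hJ0
  have hδ : 0 < |J| / 2 := by positivity
  have hlim : Tendsto (fun t => ‖T (Φ t)‖) atTop (𝓝 |J|) := by
    have := ((tendsto_integral_modulate φ fun x => a x + b x).sub_const (J : ℂ)).norm
    rw [zero_sub, norm_neg, Complex.norm_real, Real.norm_eq_abs] at this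
    refine this.congr fun t => ?_
    rw [hT, hΦ, distDiv_modulate hm hv ha hb hma hmb hφ hc t]
  obtain ⟨t₀, ht₀⟩ := eventually_atTop.1 (hlim.eventually_const_lt (half_lt_self (abs_pos.2 hJ0)))
  obtain ⟨t, htt, ht⟩ := exists_lintegral_translate_lt hf hfin (𝓕⁻ (Φ 0)) hδ (le_max_right t₀ 0)
  refine absurd ht (not_lt.2 ?_)
  have hψ : ∀ ξ, (𝓕⁻ (Φ t)) ξ = (𝓕⁻ (Φ 0)) (ξ + t • stdVec 0) := by
    intro ξ
    rw [SchwartzMap.fourierInv_coe, SchwartzMap.fourierInv_coe]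
    exact fourierInv_modulate φ t ξ
  have hTt : T (Φ t) = ∫ ξ, (𝓕⁻ (Φ t)) ξ * f ξ := by
    rw [← (hrep (𝓕⁻ (Φ t))).2, TemperedDistribution.fourier_apply]
    simp
  calc ENNReal.ofReal (|J| / 2) ≤ ENNReal.ofReal ‖T (Φ t)‖ :=
        ENNReal.ofReal_le_ofReal (ht₀ t ((le_max_left _ _).trans htt.le)).le
    _ = ‖∫ ξ, (𝓕⁻ (Φ t)) ξ * f ξ‖ₑ := by rw [ofReal_norm, hTt]
    _ ≤ ∫⁻ ξ, ‖(𝓕⁻ (Φ t)) ξ * f ξ‖ₑ := enorm_integral_le_lintegral_enorm _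
    _ = _ := by
      refine lintegral_congr fun ξ => ?_
      rw [enorm_mul, hψ, mul_comm]

end

/-! ### Traces of functions without boundary term -/

theorem measurePreserving_mk_plane :
    MeasurePreserving (fun p : ℝ × ℝ => (!₂[p.1, p.2] : Plane)) volume volume :=
  (PiLp.volume_preserving_toLp (Fin 2)).comp (volume_preserving_finTwoArrow ℝ).symm

theorem measurableEmbedding_mk_plane :
    MeasurableEmbedding (fun p : ℝ × ℝ => (!₂[p.1, p.2] : Plane)) :=
  (MeasurableEquiv.finTwoArrow.symm.trans
    (MeasurableEquiv.toLp 2 (Fin 2 → ℝ))).measurableEmbedding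

theorem mk_plane_add (p : ℝ × ℝ) : (!₂[p.1, p.2] : Plane) = p.1 • stdVec 0 + p.2 • stdVec 1 := by
  ext i
  fin_cases i <;> simp [stdVec]

/-- The fundamental theorem of calculus in the `x₁`-direction on the half-plane. -/
theorem setIntegral_fderiv_halfPlane {F : Plane → ℝ} (hF : ContDiff ℝ ∞ F)
    (hc : HasCompactSupport F) :
    ∫ x in halfPlane, fderiv ℝ F x (stdVec 0) = ∫ s, F !₂[0, s] := by
  have hcD := continuous_fderiv_stdVec hF 0
  have hint : Integrable fun x => fderiv ℝ F x (stdVec 0) :=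
    hcD.integrable_of_hasCompactSupport (hasCompactSupport_fderiv_stdVec hc 0)
  have hpre : (fun p : ℝ × ℝ => (!₂[p.1, p.2] : Plane)) ⁻¹' halfPlane
      = Set.Iio 0 ×ˢ Set.univ := by
    ext p
    simp [halfPlane]
  rw [← measurePreserving_mk_plane.setIntegral_preimage_emb measurableEmbedding_mk_plane, hpre,
    Measure.volume_eq_prod, ← Measure.prod_restrict, Measure.restrict_univ, integral_prod_symm]
  · refine integral_congr_ae (Eventually.of_forall fun s => ?_)
    have hline : ∀ r : ℝ, HasDerivAt (fun r : ℝ => F !₂[r, s])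
        (fderiv ℝ F !₂[r, s] (stdVec 0)) r := by
      intro r
      have h1 : HasDerivAt (fun r : ℝ => (!₂[r, s] : Plane)) (stdVec 0) r := by
        simp only [fun r : ℝ => mk_plane_add (r, s)]
        simpa using ((hasDerivAt_id r).smul_const (stdVec 0)).add_const (s • stdVec 1)
      exact (hF.differentiable (by simp) _).hasFDerivAt.comp_hasDerivAt r h1
    have hemb : ContDiff ℝ ∞ fun r : ℝ => (!₂[r, s] : Plane) := by
      simp only [fun r : ℝ => mk_plane_add (r, s)]
      fun_prop
    have hcs : HasCompactSupport fun r : ℝ => F !₂[r, s] := by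
      refine hc.comp_isClosedEmbedding (g := fun r : ℝ => (!₂[r, s] : Plane)) ?_
      have hiso : Isometry fun r : ℝ => (!₂[r, s] : Plane) := by
        refine Isometry.of_dist_eq fun r r' => ?_
        simp [EuclideanSpace.dist_eq, Real.sqrt_sq_eq_abs, Real.dist_eq]
      exact hiso.isClosedEmbedding
    have h2 := hcs.integral_Iic_deriv_eq ((hF.comp hemb).of_le (by simp)) 0
    rw [integral_Iic_eq_integral_Iio] at h2
    change _ = F !₂[(0 : ℝ), s] at h2
    exact (integral_congr_ae (Eventually.of_forall fun r => (hline r).deriv.symm)).trans h2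
  · have h3 : Integrable (fun p : ℝ × ℝ => fderiv ℝ F !₂[p.1, p.2] (stdVec 0)) volume :=
      (measurePreserving_mk_plane.integrable_comp_emb measurableEmbedding_mk_plane).2 hint
    rw [← Measure.restrict_univ (μ := (volume : Measure ℝ)), Measure.restrict_restrict_of_subset
      (Set.subset_univ _), Measure.prod_restrict]
    exact h3.integrableOn

theorem MeasureTheory.MemLp.integrable_fun_mul_two {α : Type*} {mα : MeasurableSpace α}
    {μ : Measure α} {f g : α → ℝ} (hf : MemLp f 2 μ) (hg : MemLp g 2 μ) : Integrable (fun x => f x * g x) μ :=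
  hf.integrable_mul hg

theorem tendsto_integral_mul_of_eLpNorm_two {α : Type*} {mα : MeasurableSpace α} {μ : Measure α}
    {ψ u : α → ℝ} {v : ℕ → α → ℝ} (hψ : MemLp ψ 2 μ) (hu : MemLp u 2 μ)
    (hv : ∀ n, MemLp (v n) 2 μ)
    (h : Tendsto (fun n => eLpNorm (fun x => v n x - u x) 2 μ) atTop (𝓝 0)) :
    Tendsto (fun n => ∫ x, ψ x * v n x ∂μ) atTop (𝓝 (∫ x, ψ x * u x ∂μ)) := by
  refine tendsto_integral_of_L1' _ (hψ.integrable_mul hu).aestronglyMeasurable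
    (Eventually.of_forall fun n => hψ.integrable_mul (hv n)) ?_
  have h0 : Tendsto (fun n => eLpNorm ψ 2 μ * eLpNorm (fun x => v n x - u x) 2 μ) atTop (𝓝 0) := by
    simpa using ENNReal.Tendsto.const_mul h (Or.inr hψ.eLpNorm_ne_top)
  refine tendsto_of_tendsto_of_tendsto_of_le_of_le tendsto_const_nhds h0 (fun _ => bot_le)
    fun n => ?_
  refine le_trans (le_of_eq (congrArg (fun g => eLpNorm g 1 μ) ?_))
    (eLpNorm_smul_le_mul_eLpNorm ((hv n).sub hu).aestronglyMeasurable hψ.aestronglyMeasurable)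
  ext x
  simp [mul_sub]

theorem eLpNorm_two_sq {α E : Type*} [NormedAddCommGroup E] {mα : MeasurableSpace α}
    (μ : Measure α) (f : α → E) : eLpNorm f 2 μ ^ 2 = ∫⁻ x, ‖f x‖ₑ ^ 2 ∂μ := by
  have h := eLpNorm_nnreal_pow_eq_lintegral (f := f) (μ := μ) (p := 2) two_ne_zero
  simpa using h

theorem tendsto_eLpNorm_two_of_sq {α ι E : Type*} [NormedAddCommGroup E] {mα : MeasurableSpace α}
    {μ : Measure α} {l : Filter ι} {f : ι → α → E}
    (h : Tendsto (fun n => ∫⁻ x, ‖f n x‖ₑ ^ 2 ∂μ) l (𝓝 0)) :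
    Tendsto (fun n => eLpNorm (f n) 2 μ) l (𝓝 0) := by
  have h1 := (ENNReal.continuous_rpow_const (y := 1 / 2)).continuousAt.tendsto.comp h
  simp only [← eLpNorm_two_sq] at h1
  refine (h1.congr fun n => ?_).trans (by simp)
  simp only [Function.comp_apply]
  rw [← ENNReal.rpow_natCast, ← ENNReal.rpow_mul]
  simp

theorem MemHHalf.memLp {g : ℝ → ℝ} (hg : MemHHalf g) : MemLp g 2 volume := by
  refine ⟨hg.1, ?_⟩
  have h : ∫⁻ s, ‖g s‖ₑ ^ 2 < ⊤ := le_self_add.trans_lt hg.2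
  rw [← eLpNorm_two_sq] at h
  exact (ENNReal.pow_lt_top_iff).1 h |>.resolve_right two_ne_zero

/-- If integration by parts of `u` against `∂₁` has no boundary terms, every trace of `u` is `0`:
the boundary term of the approximating `v n` is the pairing of `v n (0, ·)` with the test function. -/
theorem IsTrace.ae_eq_zero {u : Plane → ℝ} {g : ℝ → ℝ} (hg : IsTrace u g)
    (hu : ∀ a : Plane → ℝ, MemLp a 2 (volume.restrict halfPlane) → IsWeakPartial halfPlane 0 u a →
      ∀ φ : Plane → ℝ, ContDiff ℝ ∞ φ → HasCompactSupport φ →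
        ∫ x in halfPlane, (fderiv ℝ φ x (stdVec 0) * u x + φ x * a x) = 0) :
    g =ᵐ[volume] 0 := by
  obtain ⟨hgH, w, hw, v, hv, hv0, hv1, hvg⟩ := hg
  have hgL := hgH.memLp
  have hslice : ContDiff ℝ ∞ fun s : ℝ => (!₂[(0 : ℝ), s] : Plane) := by
    simp only [fun s : ℝ => mk_plane_add (0, s)]
    fun_prop
  have hsliceC : Topology.IsClosedEmbedding fun s : ℝ => (!₂[(0 : ℝ), s] : Plane) := by
    refine Isometry.isClosedEmbedding (Isometry.of_dist_eq fun r r' => ?_)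
    simp [EuclideanSpace.dist_eq, Real.sqrt_sq_eq_abs, Real.dist_eq]
  -- the pairing of `g` with the restriction of a test function to the line vanishes
  have key : ∀ φ : Plane → ℝ, ContDiff ℝ ∞ φ → HasCompactSupport φ →
      ∫ s, φ !₂[0, s] * g s = 0 := by
    intro φ hφ hc
    have hφL : MemLp φ 2 (volume.restrict halfPlane) :=
      memLp_of_continuous_of_hasCompactSupport hφ.continuous hc _ 2
    have hdL : MemLp (fun x => fderiv ℝ φ x (stdVec 0)) 2 (volume.restrict halfPlane) :=
      memLp_of_continuous_of_hasCompactSupport (continuous_fderiv_stdVec hφ 0)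
        (hasCompactSupport_fderiv_stdVec hc 0) _ 2
    have hvL : ∀ n, MemLp (v n) 2 (volume.restrict halfPlane) := fun n =>
      memLp_of_continuous_of_hasCompactSupport (hv n).1.continuous (hv n).2 _ 2
    have hvdL : ∀ n, MemLp (fun x => fderiv ℝ (v n) x (stdVec 0)) 2
        (volume.restrict halfPlane) := fun n =>
      memLp_of_continuous_of_hasCompactSupport (continuous_fderiv_stdVec (hv n).1 0)
        (hasCompactSupport_fderiv_stdVec (hv n).2 0) _ 2
    have l1 := (tendsto_integral_mul_of_eLpNorm_two hdL hw.memLp hvL hv0).add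
      (tendsto_integral_mul_of_eLpNorm_two hφL (hw.memLp_grad 0) hvdL (hv1 0))
    rw [← integral_add (hdL.integrable_fun_mul_two hw.memLp)
        (hφL.integrable_fun_mul_two (hw.memLp_grad 0)),
      hu (w 0) (hw.memLp_grad 0) (hw.weak 0) φ hφ hc] at l1
    have l2 : Tendsto (fun n => ∫ s, φ !₂[0, s] * v n !₂[0, s]) atTop
        (𝓝 (∫ s, φ !₂[0, s] * g s)) := by
      refine tendsto_integral_mul_of_eLpNorm_two ?_ hgL (fun n => ?_) ?_
      · exact (hφ.comp hslice).continuous.memLp_of_hasCompactSupport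
          (hc.comp_isClosedEmbedding hsliceC)
      · exact ((hv n).1.comp hslice).continuous.memLp_of_hasCompactSupport
          ((hv n).2.comp_isClosedEmbedding hsliceC)
      · refine tendsto_eLpNorm_two_of_sq ?_
        exact tendsto_of_tendsto_of_tendsto_of_le_of_le tendsto_const_nhds hvg
          (fun _ => bot_le) fun n => le_self_add
    refine tendsto_nhds_unique l2 (l1.congr fun n => ?_)
    rw [← setIntegral_fderiv_halfPlane (hφ.mul (hv n).1) hc.mul_right,
      ← integral_add (hdL.integrable_fun_mul_two (hvL n)) (hφL.integrable_fun_mul_two (hvdL n))]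
    refine integral_congr_ae (Eventually.of_forall fun x => ?_)
    have := ((hφ.differentiable (by simp) x).hasFDerivAt.mul
      ((hv n).1.differentiable (by simp) x).hasFDerivAt).fderiv
    change _ = fderiv ℝ (φ * v n) x (stdVec 0)
    rw [this]
    simp only [add_apply, smul_apply, smul_eq_mul]
    ring
  refine ae_eq_zero_of_integral_contDiff_smul_eq_zero (hgL.locallyIntegrable (by simp))
    fun b hb hbc => ?_
  -- extend the one-dimensional test function to the plane by a bump function in `x₁`
  let β : ContDiffBump (0 : ℝ) := ⟨1, 2, one_pos, one_lt_two⟩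
  have hproj : ∀ i, ContDiff ℝ ∞ (fun y : Plane => y i) := fun i =>
    (EuclideanSpace.proj i : Plane →L[ℝ] ℝ).contDiff
  have h := key (fun x => β (x 0) * b (x 1)) ((β.contDiff.comp (hproj 0)).mul (hb.comp (hproj 1)))
    ?_
  · have hβ : β 0 = 1 := β.one_of_mem_closedBall (by simp [β])
    simpa [hβ] using h
  · have hK : IsCompact ((fun p : ℝ × ℝ => (!₂[p.1, p.2] : Plane)) ''
        (tsupport β ×ˢ tsupport b)) := by
      refine (β.hasCompactSupport.isCompact.prod hbc.isCompact).image ?_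
      simp only [mk_plane_add]
      fun_prop
    refine HasCompactSupport.intro hK fun x hx => ?_
    by_contra hne
    refine hx ⟨(x 0, x 1), ⟨subset_tsupport _ (left_ne_zero_of_mul hne),
      subset_tsupport _ (right_ne_zero_of_mul hne)⟩, ?_⟩
    ext i
    fin_cases i <;> rfl

/-! ### Approximation by smooth functions vanishing on the line -/

theorem tendsto_eLpNorm_translate_sub {f : Plane → ℝ} (hf : MemLp f 2 volume) :
    Tendsto (fun y => eLpNorm (fun x => f (x - y) - f x) 2 volume) (𝓝 0) (𝓝 0) := by
  have : Fact ((2 : ℝ≥0∞) ≠ ⊤) := ⟨by simp⟩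
  have h1 : Continuous fun y : Plane => DomAddAct.mk (-y) +ᵥ hf.toLp f := by
    have : Continuous fun y : Plane => DomAddAct.mk (-y) :=
      DomAddAct.continuous_mk.comp continuous_neg
    exact this.vadd continuous_const
  have h2 := (h1.edist continuous_const (g := fun _ => hf.toLp f)).tendsto 0
  have h3 : DomAddAct.mk (-(0 : Plane)) +ᵥ hf.toLp f = hf.toLp f := by simp
  rw [h3, edist_self] at h2
  refine h2.congr fun y => ?_
  rw [DomAddAct.mk_vadd_toLp, Lp.edist_toLp_toLp]
  refine congrArg (fun g => eLpNorm g 2 volume) ?_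
  ext x
  simp [sub_eq_neg_add]

/-- Averaging translates of `f` against a probability density `k` moves `f` in `L²` by no more
than the translations in the support of `k` do. -/
theorem eLpNorm_convolution_sub_le {k f : Plane → ℝ} (hk : Continuous k)
    (hkc : HasCompactSupport k) (hk0 : ∀ y, 0 ≤ k y) (hk1 : ∫ y, k y = 1)
    (hf : MemLp f 2 volume) {ε : ℝ≥0∞}
    (hε : ∀ y, k y ≠ 0 → eLpNorm (fun x => f (x - y) - f x) 2 volume ≤ ε) :
    eLpNorm (fun x => convolution k f (ContinuousLinearMap.lsmul ℝ ℝ) volume x - f x) 2 volume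
      ≤ ε := by
  have hkm : Measurable fun y => ENNReal.ofReal (k y) := hk.measurable.ennreal_ofReal
  have hkI : Integrable k := hk.integrable_of_hasCompactSupport hkc
  have hk1' : ∫⁻ y, ENNReal.ofReal (k y) = 1 := by
    rw [← ofReal_integral_eq_lintegral_ofReal hkI (Eventually.of_forall hk0), hk1,
      ENNReal.ofReal_one]
  set κ : Measure Plane := volume.withDensity fun y => ENNReal.ofReal (k y) with hκ
  have : IsProbabilityMeasure κ := ⟨by rw [hκ, withDensity_apply _ .univ]; simpa using hk1'⟩
  have hfl := hf.locallyIntegrable (by simp : (1 : ℝ≥0∞) ≤ 2)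
  have hfy : ∀ x : Plane, AEStronglyMeasurable (fun y => f (x - y) - f x) volume := fun x =>
    (hf.aestronglyMeasurable.comp_quasiMeasurePreserving
      (quasiMeasurePreserving_sub_left volume x)).sub aestronglyMeasurable_const
  have hsub : AEStronglyMeasurable (fun p : Plane × Plane => f (p.1 - p.2) - f p.1)
      (volume.prod volume) :=
    (hf.aestronglyMeasurable.comp_quasiMeasurePreserving
      (quasiMeasurePreserving_sub_of_right_invariant volume volume)).sub
      (hf.aestronglyMeasurable.comp_quasiMeasurePreserving Measure.quasiMeasurePreserving_fst)
  have hpt : ∀ x, ‖convolution k f (ContinuousLinearMap.lsmul ℝ ℝ) volume x - f x‖ₑ ^ 2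
      ≤ ∫⁻ y, ENNReal.ofReal (k y) * ‖f (x - y) - f x‖ₑ ^ 2 := by
    intro x
    have hex : Integrable fun y => k y * f (x - y) :=
      hkc.convolutionExists_left (ContinuousLinearMap.lsmul ℝ ℝ) hk hfl x
    have h1 : convolution k f (ContinuousLinearMap.lsmul ℝ ℝ) volume x - f x
        = ∫ y, k y * (f (x - y) - f x) := by
      simp only [mul_sub]
      rw [integral_sub hex (hkI.mul_const _), integral_mul_const, hk1, one_mul, convolution_def]
      rfl
    have h2 : ‖∫ y, k y * (f (x - y) - f x)‖ₑ ≤ eLpNorm (fun y => f (x - y) - f x) 1 κ := by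
      refine (enorm_integral_le_lintegral_enorm _).trans (le_of_eq ?_)
      rw [eLpNorm_one_eq_lintegral_enorm, hκ,
        lintegral_withDensity_eq_lintegral_mul₀ hkm.aemeasurable (hfy x).enorm]
      refine lintegral_congr fun y => ?_
      rw [enorm_mul, Real.enorm_eq_ofReal (hk0 y)]
      rfl
    have h3 : eLpNorm (fun y => f (x - y) - f x) 1 κ ≤ eLpNorm (fun y => f (x - y) - f x) 2 κ :=
      eLpNorm_le_eLpNorm_of_exponent_le (by simp)
        ((hfy x).mono_ac (withDensity_absolutelyContinuous _ _))
    rw [h1]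
    calc _ ≤ eLpNorm (fun y => f (x - y) - f x) 2 κ ^ 2 := by
          gcongr
          exact h2.trans h3
      _ = _ := by
          rw [eLpNorm_two_sq, hκ, lintegral_withDensity_eq_lintegral_mul₀ hkm.aemeasurable
            ((hfy x).enorm.pow_const 2)]
          rfl
  refine (ENNReal.pow_le_pow_left_iff two_ne_zero).1 ?_
  rw [eLpNorm_two_sq]
  calc _ ≤ ∫⁻ x, ∫⁻ y, ENNReal.ofReal (k y) * ‖f (x - y) - f x‖ₑ ^ 2 := lintegral_mono hpt
    _ = ∫⁻ y, ∫⁻ x, ENNReal.ofReal (k y) * ‖f (x - y) - f x‖ₑ ^ 2 :=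
        lintegral_lintegral_swap ((hkm.comp measurable_snd).aemeasurable.mul
          (hsub.enorm.pow_const 2))
    _ = ∫⁻ y, ENNReal.ofReal (k y) * eLpNorm (fun x => f (x - y) - f x) 2 volume ^ 2 := by
        refine lintegral_congr fun y => ?_
        rw [lintegral_const_mul' _ _ ENNReal.ofReal_ne_top, eLpNorm_two_sq]
    _ ≤ ∫⁻ y, ENNReal.ofReal (k y) * ε ^ 2 := by
        refine lintegral_mono fun y => ?_
        by_cases hy : k y = 0
        · simp [hy]
        · gcongr
          exact hε y hy
    _ = ε ^ 2 := by rw [lintegral_mul_const _ hkm, hk1', one_mul]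

theorem tendsto_eLpNorm_convolution_sub {k : ℕ → Plane → ℝ} {R : ℕ → ℝ} {f : Plane → ℝ}
    (hk : ∀ n, Continuous (k n)) (hkc : ∀ n, HasCompactSupport (k n))
    (hk0 : ∀ n y, 0 ≤ k n y) (hk1 : ∀ n, ∫ y, k n y = 1)
    (hR : Tendsto R atTop (𝓝 0)) (hkR : ∀ n y, k n y ≠ 0 → ‖y‖ < R n) (hf : MemLp f 2 volume) :
    Tendsto (fun n => eLpNorm (fun x =>
      convolution (k n) f (ContinuousLinearMap.lsmul ℝ ℝ) volume x - f x) 2 volume)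
      atTop (𝓝 0) := by
  refine ENNReal.tendsto_nhds_zero.2 fun ε hε => ?_
  have h := ENNReal.tendsto_nhds_zero.1 (tendsto_eLpNorm_translate_sub hf) ε hε
  obtain ⟨r, hr, hball⟩ := Metric.eventually_nhds_iff.1 h
  filter_upwards [hR.eventually_lt_const hr] with n hn
  refine eLpNorm_convolution_sub_le (hk n) (hkc n) (hk0 n) (hk1 n) hf fun y hy => ?_
  exact hball (by simpa using (hkR n y hy).trans hn)

/-- A function whose weak derivative has no boundary term can be differentiated under the
convolution after extension by zero. -/
theorem fderiv_convolution_indicator {k u w : Plane → ℝ} {i : Fin 2} (hk : ContDiff ℝ ∞ k)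
    (hkc : HasCompactSupport k) (hu : MemLp u 2 (volume.restrict halfPlane))
    (hw : MemLp w 2 (volume.restrict halfPlane))
    (h : ∀ φ : Plane → ℝ, ContDiff ℝ ∞ φ → HasCompactSupport φ →
      ∫ x in halfPlane, (fderiv ℝ φ x (stdVec i) * u x + φ x * w x) = 0) (x : Plane) :
    fderiv ℝ (convolution k (halfPlane.indicator u) (ContinuousLinearMap.lsmul ℝ ℝ) volume) x
        (stdVec i)
      = convolution k (halfPlane.indicator w) (ContinuousLinearMap.lsmul ℝ ℝ) volume x := by
  have hul : LocallyIntegrable (halfPlane.indicator u) volume :=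
    ((memLp_indicator_iff_restrict measurableSet_halfPlane).2 hu).locallyIntegrable (by simp)
  have hD : Continuous (fderiv ℝ k) := hk.continuous_fderiv (by simp)
  have hex := (hkc.fderiv ℝ).convolutionExists_left
    (ContinuousLinearMap.precompL Plane (ContinuousLinearMap.lsmul ℝ ℝ)) hD hul x
  rw [(hkc.hasFDerivAt_convolution_left (ContinuousLinearMap.lsmul ℝ ℝ) (hk.of_le (by simp))
    hul x).fderiv, convolution_def, ContinuousLinearMap.integral_apply hex, convolution_def]
  simp only [ContinuousLinearMap.precompL_apply, ContinuousLinearMap.lsmul_apply, smul_eq_mul]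
  rw [← integral_sub_left_eq_self (fun t => fderiv ℝ k t (stdVec i) * _) volume x,
    ← integral_sub_left_eq_self (fun t => k t * _) volume x]
  simp only [sub_sub_cancel]
  -- the test function is `k` reflected and translated
  have hφ : ContDiff ℝ ∞ fun y => k (x - y) := hk.comp (contDiff_const.sub contDiff_id)
  have hφc : HasCompactSupport fun y => k (x - y) :=
    hkc.comp_homeomorph (Homeomorph.subLeft x)
  have hd : ∀ y, fderiv ℝ (fun y => k (x - y)) y (stdVec i)
      = -fderiv ℝ k (x - y) (stdVec i) := by
    intro y
    have := ((hk.differentiable (by simp) (x - y)).hasFDerivAt.comp y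
      ((hasFDerivAt_id y).const_sub x)).fderiv
    change fderiv ℝ (fun y => k (x - y)) y = _ at this
    rw [this]
    simp
  have hI1 : Integrable (fun y => fderiv ℝ (fun y => k (x - y)) y (stdVec i) * u y)
      (volume.restrict halfPlane) :=
    (memLp_of_continuous_of_hasCompactSupport (continuous_fderiv_stdVec hφ i)
      (hasCompactSupport_fderiv_stdVec hφc i) _ 2).integrable_mul hu
  have hI2 : Integrable (fun y => k (x - y) * w y) (volume.restrict halfPlane) :=
    (memLp_of_continuous_of_hasCompactSupport hφ.continuous hφc _ 2).integrable_mul hw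
  have h0 := h _ hφ hφc
  rw [integral_add hI1 hI2] at h0
  simp only [hd, neg_mul, integral_neg] at h0
  have hind : ∀ a b : Plane → ℝ, ∫ y, a y * halfPlane.indicator b y
      = ∫ y in halfPlane, a y * b y := by
    intro a b
    rw [← integral_indicator measurableSet_halfPlane]
    refine integral_congr_ae (Eventually.of_forall fun y => ?_)
    by_cases hy : y ∈ halfPlane <;> simp [hy]
  rw [hind, hind]
  linarith

theorem tendsto_eLpNorm_cutoff_mul_sub {ρ : ℕ → Plane → ℝ} {F : ℕ → Plane → ℝ} {f : Plane → ℝ}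
    (hρ : ∀ n, Continuous (ρ n)) (hρ1 : ∀ n x, |ρ n x| ≤ 1)
    (hρl : ∀ x, ∀ᶠ n in atTop, ρ n x = 1) (hF : ∀ n, AEStronglyMeasurable (F n) volume)
    (hf : MemLp f 2 volume)
    (hFf : Tendsto (fun n => eLpNorm (fun x => F n x - f x) 2 volume) atTop (𝓝 0)) :
    Tendsto (fun n => eLpNorm (fun x => ρ n x * F n x - f x) 2 volume) atTop (𝓝 0) := by
  have h1 : Tendsto (fun n => eLpNorm (fun x => (ρ n x - 1) * f x) 2 volume) atTop (𝓝 0) := by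
    refine tendsto_eLpNorm_two_of_sq ?_
    have hfin : ∫⁻ x, (2 * ‖f x‖ₑ) ^ 2 ≠ ⊤ := by
      simp only [mul_pow]
      rw [lintegral_const_mul' _ _ (by simp), ← eLpNorm_two_sq]
      exact ENNReal.mul_ne_top (by simp) (ENNReal.pow_ne_top hf.eLpNorm_ne_top)
    have hlim := tendsto_lintegral_of_dominated_convergence' (μ := volume)
      (F := fun n x => ‖(ρ n x - 1) * f x‖ₑ ^ 2) (f := fun _ => 0)
      (fun x => (2 * ‖f x‖ₑ) ^ 2) (fun n => ?_) (fun n => ?_) hfin ?_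
    · simpa using hlim
    · exact (((hρ n).sub continuous_const).aestronglyMeasurable.mul
        hf.aestronglyMeasurable).enorm.pow_const 2
    · refine Eventually.of_forall fun x => ?_
      simp only [enorm_mul]
      gcongr
      rw [← ofReal_norm, ENNReal.ofReal_le_iff_le_toReal (by simp), ENNReal.toReal_ofNat,
        Real.norm_eq_abs, abs_le]
      have := abs_le.1 (hρ1 n x)
      constructor <;> linarith
    · refine Eventually.of_forall fun x => tendsto_const_nhds.congr' ?_
      filter_upwards [hρl x] with n hn
      simp [hn]
  have h2 := hFf.add h1
  rw [add_zero] at h2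
  refine tendsto_of_tendsto_of_tendsto_of_le_of_le tendsto_const_nhds h2 (fun _ => bot_le)
    fun n => ?_
  have hsplit : (fun x => ρ n x * F n x - f x)
      = (fun x => ρ n x * (F n x - f x)) + fun x => (ρ n x - 1) * f x := by
    ext x
    simp only [Pi.add_apply]
    ring
  rw [hsplit]
  refine (eLpNorm_add_le ((hρ n).aestronglyMeasurable.mul ((hF n).sub hf.aestronglyMeasurable))
    (((hρ n).sub continuous_const).aestronglyMeasurable.mul hf.aestronglyMeasurable)
    (by simp)).trans (add_le_add ?_ le_rfl)
  refine eLpNorm_mono fun x => ?_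
  simp only [Pi.mul_apply, Pi.sub_apply, norm_mul]
  exact mul_le_of_le_one_left (norm_nonneg _) (hρ1 n x)

/-- Cutoff functions at infinity: `1` on larger and larger balls, with gradients tending to `0`. -/
theorem exists_cutoff_at_infinity : ∃ (ρ : ℕ → Plane → ℝ) (C : ℕ → ℝ),
    (∀ n, ContDiff ℝ ∞ (ρ n)) ∧ (∀ n, HasCompactSupport (ρ n)) ∧ (∀ n x, |ρ n x| ≤ 1) ∧
    (∀ x, ∀ᶠ n in atTop, ρ n x = 1) ∧ (∀ n i x, |fderiv ℝ (ρ n) x (stdVec i)| ≤ C n) ∧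
    Tendsto C atTop (𝓝 0) := by
  let β : ContDiffBump (0 : Plane) := ⟨1, 2, one_pos, one_lt_two⟩
  have hβ : ContDiff ℝ ∞ β := β.contDiff
  obtain ⟨L, hL⟩ := (β.hasCompactSupport.fderiv ℝ).exists_bound_of_continuous
    (hβ.continuous_fderiv (by simp))
  set c : ℕ → ℝ := fun n => 1 / ((n : ℝ) + 1) with hc
  have hcpos : ∀ n, 0 < c n := fun n => by positivity
  have hc0 : Tendsto c atTop (𝓝 0) := tendsto_one_div_add_atTop_nhds_zero_nat
  refine ⟨fun n x => β (c n • x), fun n => L * c n, fun n => hβ.comp (contDiff_id.const_smul _),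
    fun n => ?_, fun n x => ?_, fun x => ?_, fun n i x => ?_, ?_⟩
  · exact β.hasCompactSupport.comp_homeomorph (Homeomorph.smulOfNeZero (c n) (hcpos n).ne')
  · rw [abs_of_nonneg β.nonneg]
    exact β.le_one
  · have h1 : Tendsto (fun n => c n • x) atTop (𝓝 0) := by
      simpa using hc0.smul_const x
    filter_upwards [h1.eventually (Metric.closedBall_mem_nhds 0 one_pos)] with n hn
    exact β.one_of_mem_closedBall hn
  · have h1 := ((hβ.differentiable (by simp) (c n • x)).hasFDerivAt.comp x
      ((hasFDerivAt_id x).const_smul (c n))).fderiv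
    change fderiv ℝ (fun x => β (c n • x)) x = _ at h1
    rw [h1]
    have h2 := (fderiv ℝ β (c n • x)).le_of_opNorm_le (hL (c n • x)) (c n • stdVec i)
    simpa [stdVec, norm_smul, abs_of_pos (hcpos n)] using h2
  · simpa using hc0.const_mul L

/-- Mollifiers supported to the left of the line `{x₁ = 0}`: convolution with them keeps functions
that vanish on `{x₁ ≥ 0}` within that class. -/
theorem exists_left_mollifier : ∃ (k : ℕ → Plane → ℝ) (R : ℕ → ℝ),
    (∀ n, ContDiff ℝ ∞ (k n)) ∧ (∀ n, HasCompactSupport (k n)) ∧ (∀ n y, 0 ≤ k n y) ∧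
    (∀ n, ∫ y, k n y = 1) ∧ Tendsto R atTop (𝓝 0) ∧ (∀ n y, k n y ≠ 0 → ‖y‖ < R n) ∧
    (∀ n y, k n y ≠ 0 → y 0 < 0) := by
  set r : ℕ → ℝ := fun n => 1 / ((n : ℝ) + 1) with hr
  have hrpos : ∀ n, 0 < r n := fun n => by positivity
  have hr0 : Tendsto r atTop (𝓝 0) := tendsto_one_div_add_atTop_nhds_zero_nat
  let β : ∀ n, ContDiffBump (-(r n • stdVec 0)) := fun n =>
    ⟨r n / 2, r n, half_pos (hrpos n), half_lt_self (hrpos n)⟩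
  have hsupp : ∀ n y, (β n).normed volume y ≠ 0 → ‖y + r n • stdVec 0‖ < r n := by
    intro n y hy
    have h : y ∈ Function.support ((β n).normed volume) := hy
    rw [ContDiffBump.support_normed_eq, mem_ball_iff_norm, sub_neg_eq_add] at h
    exact h
  refine ⟨fun n => (β n).normed volume, fun n => 2 * r n, fun n => (β n).contDiff_normed,
    fun n => (β n).hasCompactSupport_normed, fun n y => (β n).nonneg_normed y,
    fun n => (β n).integral_normed, by simpa using hr0.const_mul 2, fun n y hy => ?_,
    fun n y hy => ?_⟩
  · have h1 : ‖y‖ ≤ ‖y + r n • stdVec 0‖ + ‖r n • stdVec 0‖ := by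
      simpa using norm_sub_le (y + r n • stdVec 0) (r n • stdVec 0)
    have h2 : ‖r n • stdVec 0‖ = r n := by
      simp [stdVec, norm_smul, abs_of_pos (hrpos n)]
    linarith [hsupp n y hy]
  · have h1 : |(y + r n • stdVec 0) 0| ≤ ‖y + r n • stdVec 0‖ :=
      PiLp.norm_apply_le (y + r n • stdVec 0) 0
    have h2 : (y + r n • stdVec 0) 0 = y 0 + r n := by simp [stdVec]
    rw [h2] at h1
    linarith [le_abs_self (y 0 + r n), hsupp n y hy]

theorem hHalfNormSq_zero : hHalfNormSq (fun _ => 0) = 0 := by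
  simp [hHalfNormSq]

/-- An `H¹` function on the half-plane with no boundary terms in its integration by parts formulas
has trace `0`: its extension by zero is in `H¹(ℝ²)`, and smooth approximations of it that vanish on
the line are found by cutting off and mollifying to the left. -/
theorem isTrace_zero {u : Plane → ℝ} {w : Fin 2 → Plane → ℝ}
    (hu : IsH1WithGradient halfPlane u w)
    (h : ∀ (i : Fin 2) (φ : Plane → ℝ), ContDiff ℝ ∞ φ → HasCompactSupport φ →
      ∫ x in halfPlane, (fderiv ℝ φ x (stdVec i) * u x + φ x * w i x) = 0) :
    IsTrace u (fun _ => 0) := by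
  obtain ⟨ρ, C, hρ, hρc, hρ1, hρl, hρC, hCl⟩ := exists_cutoff_at_infinity
  obtain ⟨k, R, hk, hkc, hk0, hk1, hR, hkR, hkleft⟩ := exists_left_mollifier
  have hE : ∀ {f : Plane → ℝ}, MemLp f 2 (volume.restrict halfPlane) →
      MemLp (halfPlane.indicator f) 2 volume := fun hf =>
    (memLp_indicator_iff_restrict measurableSet_halfPlane).2 hf
  set S : ℕ → (Plane → ℝ) → Plane → ℝ := fun n f =>
    convolution (k n) (halfPlane.indicator f) (ContinuousLinearMap.lsmul ℝ ℝ) volume with hS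
  have hSc : ∀ n {f : Plane → ℝ}, MemLp f 2 (volume.restrict halfPlane) →
      ContDiff ℝ ∞ (S n f) := fun n f hf =>
    (hkc n).contDiff_convolution_left _ (hk n) ((hE hf).locallyIntegrable (by simp))
  have hSl : ∀ {f : Plane → ℝ}, MemLp f 2 (volume.restrict halfPlane) →
      Tendsto (fun n => eLpNorm (fun x => S n f x - halfPlane.indicator f x) 2 volume)
        atTop (𝓝 0) := fun hf =>
    tendsto_eLpNorm_convolution_sub (fun n => (hk n).continuous) hkc hk0 hk1 hR hkR (hE hf)
  have hρSl : ∀ {f : Plane → ℝ}, MemLp f 2 (volume.restrict halfPlane) →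
      Tendsto (fun n => eLpNorm (fun x => ρ n x * S n f x - halfPlane.indicator f x) 2 volume)
        atTop (𝓝 0) := fun hf =>
    tendsto_eLpNorm_cutoff_mul_sub (fun n => (hρ n).continuous) hρ1 hρl
      (fun n => (hSc n hf).continuous.aestronglyMeasurable) (hE hf) (hSl hf)
  have hrestrict : ∀ (F : Plane → ℝ) (f : Plane → ℝ),
      eLpNorm (fun x => F x - f x) 2 (volume.restrict halfPlane)
        ≤ eLpNorm (fun x => F x - halfPlane.indicator f x) 2 volume := by
    intro F f
    refine le_trans (le_of_eq (eLpNorm_congr_ae ?_))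
      (eLpNorm_mono_measure _ Measure.restrict_le_self)
    refine (ae_restrict_iff' measurableSet_halfPlane).2 (Eventually.of_forall fun x hx => ?_)
    simp [hx]
  refine ⟨⟨aestronglyMeasurable_const, ?_⟩, w, hu, fun n x => ρ n x * S n u x,
    fun n => ⟨(hρ n).mul (hSc n hu.memLp), (hρc n).mul_right⟩, ?_, fun i => ?_, ?_⟩
  · rw [hHalfNormSq_zero]
    exact ENNReal.zero_lt_top
  · exact tendsto_of_tendsto_of_tendsto_of_le_of_le tendsto_const_nhds (hρSl hu.memLp)
      (fun _ => bot_le) fun n => hrestrict _ _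
  · have hder : ∀ n x, fderiv ℝ (fun x => ρ n x * S n u x) x (stdVec i)
        = ρ n x * S n (w i) x + fderiv ℝ (ρ n) x (stdVec i) * S n u x := by
      intro n x
      have h1 := (((hρ n).differentiable (by simp) x).hasFDerivAt.mul
        ((hSc n hu.memLp).differentiable (by simp) x).hasFDerivAt).fderiv
      have h2 := fderiv_convolution_indicator (hk n) (hkc n) hu.memLp (hu.memLp_grad i) (h i) x
      change fderiv ℝ (S n u) x (stdVec i) = S n (w i) x at h2
      rw [show (fun x => ρ n x * S n u x) = ρ n * S n u from rfl, h1]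
      simp only [add_apply, smul_apply, smul_eq_mul, h2]
      ring
    -- the gradient of the cutoff contributes `C n` times a bounded quantity
    have hbd : Tendsto (fun n => ENNReal.ofReal (C n) *
        (eLpNorm (fun x => S n u x - halfPlane.indicator u x) 2 volume
          + eLpNorm (halfPlane.indicator u) 2 volume)) atTop (𝓝 0) := by
      have h1 : Tendsto (fun n => ENNReal.ofReal (C n)) atTop (𝓝 0) := by
        simpa using ENNReal.tendsto_ofReal hCl
      have h2 := (hSl hu.memLp).add_const (eLpNorm (halfPlane.indicator u) 2 volume)
      rw [zero_add] at h2
      simpa using ENNReal.Tendsto.mul h1 (Or.inr (hE hu.memLp).eLpNorm_ne_top) h2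
        (Or.inr ENNReal.zero_ne_top)
    have hsum := (hρSl (hu.memLp_grad i)).add hbd
    rw [add_zero] at hsum
    refine tendsto_of_tendsto_of_tendsto_of_le_of_le tendsto_const_nhds hsum
      (fun _ => bot_le) fun n => (hrestrict _ _).trans ?_
    simp only [hder]
    have hSm := (hSc n hu.memLp).continuous
    have hdm := continuous_fderiv_stdVec (hρ n) i
    have hsplit : (fun x => ρ n x * S n (w i) x + fderiv ℝ (ρ n) x (stdVec i) * S n u x
          - halfPlane.indicator (w i) x)
        = (fun x => ρ n x * S n (w i) x - halfPlane.indicator (w i) x)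
          + fun x => fderiv ℝ (ρ n) x (stdVec i) * S n u x := by
      ext x
      simp only [Pi.add_apply]
      ring
    rw [hsplit]
    refine (eLpNorm_add_le ((((hρ n).continuous.mul
      (hSc n (hu.memLp_grad i)).continuous).aestronglyMeasurable).sub
      (hE (hu.memLp_grad i)).aestronglyMeasurable) (hdm.mul hSm).aestronglyMeasurable
      (by simp)).trans (add_le_add le_rfl ?_)
    have h3 : eLpNorm (fun x => fderiv ℝ (ρ n) x (stdVec i) * S n u x) 2 volume
        ≤ ENNReal.ofReal (C n) * eLpNorm (S n u) 2 volume := by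
      refine eLpNorm_le_mul_eLpNorm_of_ae_le_mul (Eventually.of_forall fun x => ?_) 2
      rw [norm_mul]
      gcongr
      exact hρC n i x
    refine h3.trans ?_
    gcongr
    have h4 := eLpNorm_add_le (μ := volume) (p := 2)
      (hSm.aestronglyMeasurable.sub (hE hu.memLp).aestronglyMeasurable)
      (hE hu.memLp).aestronglyMeasurable (by simp)
    rwa [sub_add_cancel] at h4
  · -- the approximations vanish on the line
    have hvan : ∀ n (s : ℝ), S n u !₂[(0 : ℝ), s] = 0 := by
      intro n s
      rw [hS]
      simp only [convolution_def]
      refine integral_eq_zero_of_ae (Eventually.of_forall fun y => ?_)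
      by_cases hy : k n y = 0
      · simp [hy]
      · have h1 : (!₂[(0 : ℝ), s] - y : Plane) ∉ halfPlane := by
          simpa [halfPlane] using (hkleft n y hy).le
        simp [h1]
    simp [hvan, hHalfNormSq_zero]

/-! ### Vanishing of the normal trace -/

theorem IsH1WithGradient.coord {Ω : Set Plane} {m : Plane → Plane} {w : Fin 2 → Plane → Plane}
    (h : IsH1WithGradient Ω m w) (j : Fin 2) :
    IsH1WithGradient Ω (fun x => m x j) (fun i x => w i x j) := by
  let L : Plane →L[ℝ] ℝ := EuclideanSpace.proj j
  refine ⟨L.comp_memLp' h.memLp, fun i => L.comp_memLp' (h.memLp_grad i), fun i φ hφ hc hs => ?_⟩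
  have h1 : Integrable (fun x => fderiv ℝ φ x (stdVec i) • m x) (volume.restrict Ω) :=
    memLp_one_iff_integrable.1 (h.memLp.smul (memLp_of_continuous_of_hasCompactSupport
      (continuous_fderiv_stdVec hφ i) (hasCompactSupport_fderiv_stdVec hc i) _ 2))
  have h2 : Integrable (fun x => φ x • w i x) (volume.restrict Ω) :=
    memLp_one_iff_integrable.1 ((h.memLp_grad i).smul
      (memLp_of_continuous_of_hasCompactSupport hφ.continuous hc _ 2))
  have h3 := congrArg L (h.weak i φ hφ hc hs)
  rw [map_neg, ← L.integral_comp_comm h1, ← L.integral_comp_comm h2] at h3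
  simp only [map_smul] at h3
  exact h3

theorem proposition2 (m : Plane → Plane) (hm : MemH1 halfPlane m)
    (hfin : hDotNegHalfSq
      (distDiv (halfPlane.indicator m) (hm.memLp_indicator measurableSet_halfPlane)) < ⊤) :
    (∃ g : ℝ → ℝ, IsTrace (fun x => m x 0) g) ∧
      ∀ g : ℝ → ℝ, IsTrace (fun x => m x 0) g → g =ᵐ[volume] 0 := by
  obtain ⟨w, hw⟩ := id hm
  have h0 := hw.coord 0
  have h1 := hw.coord 1
  have hnormal : ∀ a : Plane → ℝ, MemLp a 2 (volume.restrict halfPlane) →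
      IsWeakPartial halfPlane 0 (fun x => m x 0) a → ∀ φ : Plane → ℝ, ContDiff ℝ ∞ φ →
      HasCompactSupport φ →
      ∫ x in halfPlane, (fderiv ℝ φ x (stdVec 0) * m x 0 + φ x * a x) = 0 :=
    fun a ha hma φ hφ hc => boundary_term_eq_zero hw.memLp _ ha (h1.memLp_grad 1) hma (h1.weak 1)
      hfin hφ hc
  refine ⟨⟨fun _ => 0, isTrace_zero h0 fun i φ hφ hc => ?_⟩, fun g hg => hg.ae_eq_zero hnormal⟩
  fin_cases i
  · exact hnormal _ (h0.memLp_grad 0) (h0.weak 0) φ hφ hc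
  · -- tangential derivatives never produce a boundary term
    have h2 := (h0.weak 1).integral_of_vanish h0.memLp (h0.memLp_grad 1) hφ hc (Or.inl rfl)
    have h3 := integral_add
      (MemLp.integrable_fun_mul_two (memLp_of_continuous_of_hasCompactSupport
        (continuous_fderiv_stdVec hφ 1) (hasCompactSupport_fderiv_stdVec hc 1) _ 2) h0.memLp)
      (MemLp.integrable_fun_mul_two (memLp_of_continuous_of_hasCompactSupport hφ.continuous hc _ 2)
        (h0.memLp_grad 1))
    rw [h2, neg_add_cancel] at h3
    exact h3
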